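/- Let $n\ge 2$, and let $S^{n-1}$ be the unit sphere of $\mathbb R^n$ with its surface measure. For a continuous function $f$ on $S^{n-1}$ let $Rf(\theta)=\int_{S^{n-1}\cap\theta^\perp}f(\xi)\,d\xi$, $\theta\in S^{n-1}$, be its spherical Radon transform (integration with respect to the surface measure of the unit sphere of the hyperplane $\theta^\perp$), and for $p>0$ let $\|f\|_p=\left(\int_{S^{n-1}}|f(\theta)|^p\,d\theta\right)^{1/p}$. A locally integrable function of at most polynomial growth on $\mathbb R^n$ is called a positive definite distribution if its distributional Fourier transform takes nonnegative values on all nonnegative Schwartz functions. (a) Let $p>1$ and let $g$ be an infinitely smooth, strictly positive, even function on $S^{n-1}$. Suppose that the distribution $|x|^{-1}g^{p-1}(x/|x|)$ is not positive definite on $\mathbb R^n$. Then there exists an infinitely smooth, strictly positive, even function $f$ on $S^{n-1}$ such that $Rf(\theta)\le Rg(\theta)$ for all $\theta\in S^{n-1}$, but $\|f\|_p>\|g\|_p$. (b) Let $0<p<1$ and let $f$ be an infinitely smooth, strictly positive, even function on $S^{n-1}$. Suppose that the distribution $|x|^{-1}f^{p-1}(x/|x|)$ is not positive definite on $\mathbb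 R^n$. Then there exists an infinitely smooth, strictly positive, even function $g$ on $S^{n-1}$ such that $Rf(\theta)\le Rg(\theta)$ for all $\theta\in S^{n-1}$, but $\|f\|_p>\|g\|_p$. -/

import Mathlib

open MeasureTheory Metric SchwartzMap
open scoped Manifold ContDiff ENNReal FourierTransform ComplexOrder InnerProductSpace

noncomputable section

/-- The Euclidean space `ℝ^(d+1)`. -/
abbrev Euc (d : ℕ) : Type := EuclideanSpace ℝ (Fin (d + 1))

/-- The unit sphere `S^d` of `ℝ^(d+1)`. -/
abbrev Sph (d : ℕ) : Type := sphere (0 : Euc d) 1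

/-- The surface (Lebesgue) measure on `S^d`. -/
def surfaceMeasure (d : ℕ) : Measure (Sph d) := (volume : Measure (Euc d)).toSphere

/-- `f` is infinitely differentiable on the manifold `S^d`. -/
def SphereSmooth {d : ℕ} (f : Sph d → ℝ) : Prop := ContMDiff (𝓡 d) 𝓘(ℝ, ℝ) ∞ f

/-- A unit vector of the hyperplane `θ^⊥`, regarded as a point of the sphere `S^d`. -/
def sectionPoint {d : ℕ} (θ : Sph d)
    (ξ : sphere (0 : (Submodule.span ℝ {(θ : Euc d)})ᗮ) 1) : Sph d :=
  ⟨((ξ : (Submodule.span ℝ {(θ : Euc d)})ᗮ) : Euc d), by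
    rw [mem_sphere_zero_iff_norm]
    exact mem_sphere_zero_iff_norm.mp ξ.2⟩

/-- The spherical Radon transform `Rf(θ) = ∫_{S^d ∩ θ^⊥} f(ξ) dξ`, the integral being taken with
respect to the surface measure of the unit sphere of the Euclidean space `θ^⊥`, which carries its
own `d`-dimensional Lebesgue measure
(the counting measure on two points if `d = 1`). -/
def sphericalRadon {d : ℕ} (f : Sph d → ℝ) (θ : Sph d) : ℝ :=
  ∫ ξ, f (sectionPoint θ ξ)
    ∂((volume : Measure ((Submodule.span ℝ {(θ : Euc d)})ᗮ)).toSphere)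

/-- The radial projection `x / |x|` of a nonzero vector. -/
def radialProj {d : ℕ} (x : Euc d) (hx : x ≠ 0) : Sph d :=
  ⟨‖x‖⁻¹ • x, by
    rw [mem_sphere_zero_iff_norm, norm_smul, norm_inv, norm_norm,
      inv_mul_cancel₀ (norm_ne_zero_iff.mpr hx)]⟩

open Classical in
/-- The extension `x ↦ |x|⁻¹ h(x/|x|)` of a function `h` on the sphere to a homogeneous function of
degree `-1` on `ℝ^(d+1)` (with value `0` at the origin, which is a null set). -/
def homExt {d : ℕ} (h : Sph d → ℝ) (x : Euc d) : ℝ :=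
  if hx : x ≠ 0 then ‖x‖⁻¹ * h (radialProj x hx) else 0

/-- The distribution `φ ↦ ∫ F φ` given by the function `F` is positive definite: its Fourier
transform `φ ↦ ∫ F 𝓕φ` is nonnegative on every nonnegative Schwartz function.
(Here `F` is a locally integrable function of at most polynomial growth, so that the integrals
converge. Whether the kernel of the Fourier transform is `e^{-i⟨x,ξ⟩}` or `e^{-2πi⟨x,ξ⟩}` does not
matter: the two transforms of `F` differ by a dilation and a positive factor.) -/
def IsPositiveDefiniteDistribution {d : ℕ} (F : Euc d → ℝ) : Prop :=
  ∀ φ : 𝓢(Euc d, ℂ), (∀ x, 0 ≤ φ x) → 0 ≤ ∫ x, (F x : ℂ) * (𝓕 φ) x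

/-- The functional `‖f‖_{L^p(S^d)} = (∫ |f|^p)^(1/p)`, for `0 < p < ∞`. -/
def sphereLpNorm {d : ℕ} (p : ℝ) (f : Sph d → ℝ) : ℝ≥0∞ :=
  eLpNorm f (ENNReal.ofReal p) (surfaceMeasure d)

end

/-! Write n = d + 1, and let h be g^(p-1) in (a), f^(p-1) in (b). Failure of positive definiteness
gives a Schwartz function φ ≥ 0 whose transform φ̂ pairs badly with |x|⁻¹h(x/|x|). In polar
coordinates the factor |x|⁻¹ lowers the weight r^(n-1) to r^(n-2), so the pairing equals ∫ h u over
the sphere with u(ξ) = ∫₀^∞ r^(n-2) φ̂(rξ) dr. But r^(n-2) is also the polar weight of the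
hyperplane θ^⊥, so Ru(θ) is the integral of φ̂ over θ^⊥, which by the Fourier slice theorem is ∫
φ(tθ) dt ≥ 0. Replacing u by its real part gives a smooth even function with Ru ≥ 0 and ∫ h u < 0
(`exists_sphericalRadon_nonneg_integral_mul_neg`).

It remains to perturb the given function: take f = g - εu in (a) and g = f + εu in (b), with ε small
enough to keep positivity. The Radon inequality is then linear in u, and the tangent-line inequality
for t^p (convex for p > 1, concave for p < 1) turns the sign of ∫ h u into a strict comparison of
the integrals of p-th powers. Because the tangent inequality is global, no limit ε → 0 is needed. -/

open Set in
/-- Integration in polar coordinates. -/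
theorem integral_eq_integral_toSphere_integral_Ioi {E F : Type*} [NormedAddCommGroup E]
    [NormedSpace ℝ E] [MeasurableSpace E] [BorelSpace E] [FiniteDimensional ℝ E] [Nontrivial E]
    [NormedAddCommGroup F] [NormedSpace ℝ F] (μ : Measure E) [μ.IsAddHaarMeasure]
    {G : E → F} (hG : Integrable G μ) :
    ∫ x, G x ∂μ = ∫ ξ, (∫ r in Ioi (0 : ℝ),
      r ^ (Module.finrank ℝ E - 1) • G (r • (ξ : E))) ∂μ.toSphere := by
  have hmp := μ.measurePreserving_homeomorphUnitSphereProd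
  have hemb := (homeomorphUnitSphereProd E).measurableEmbedding
  set G' : sphere (0 : E) 1 × Ioi (0 : ℝ) → F := fun z => G ((z.2 : ℝ) • (z.1 : E)) with hG'
  have hcomp : ∀ x : ({0}ᶜ : Set E), G' (homeomorphUnitSphereProd E x) = G x := by
    intro x
    have hx : ‖(x : E)‖ ≠ 0 := norm_ne_zero_iff.mpr x.2
    simp [hG', smul_smul, hx]
  have hint : Integrable G' (μ.toSphere.prod (.volumeIoiPow (Module.finrank ℝ E - 1))) := by
    rw [← hmp.integrable_comp_emb hemb]
    have : Integrable (fun x : ({0}ᶜ : Set E) => G x) (μ.comap (↑)) := by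
      have h := hG.integrableOn (s := ({0}ᶜ : Set E))
      rwa [integrableOn_iff_comap_subtypeVal (by measurability)] at h
    exact this.congr (.of_forall fun x => (hcomp x).symm)
  calc
    ∫ x, G x ∂μ = ∫ x : ({0}ᶜ : Set E), G x ∂(μ.comap (↑)) := by
      rw [integral_subtype_comap (measurableSet_singleton _).compl G, restrict_compl_singleton]
    _ = ∫ x : ({0}ᶜ : Set E), G' (homeomorphUnitSphereProd E x) ∂(μ.comap (↑)) := by
      simp only [hcomp]
    _ = ∫ z, G' z ∂(μ.toSphere.prod (.volumeIoiPow (Module.finrank ℝ E - 1))) :=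
      hmp.integral_comp hemb G'
    _ = ∫ ξ, (∫ r, G' (ξ, r) ∂(.volumeIoiPow (Module.finrank ℝ E - 1))) ∂μ.toSphere :=
      integral_prod _ hint
    _ = _ := by
      refine integral_congr_ae (.of_forall fun ξ => ?_)
      simp only [Measure.volumeIoiPow, ENNReal.ofReal]
      rw [integral_withDensity_eq_integral_smul
          ((measurable_subtype_coe.pow_const _).real_toNNReal),
        integral_subtype_comap measurableSet_Ioi
          fun a => Real.toNNReal (a ^ (Module.finrank ℝ E - 1)) • G (a • (ξ : E)),
        setIntegral_congr_fun measurableSet_Ioi fun x hx => ?_]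
      rw [NNReal.smul_def, Real.coe_toNNReal _ (pow_nonneg hx.out.le _)]

/-! ### Radial integrals of Schwartz functions and their smoothness. -/

namespace SchwartzMap

variable {E F : Type*} [NormedAddCommGroup E] [NormedSpace ℝ E] [NormedAddCommGroup F]
  [NormedSpace ℝ F]

theorem exists_norm_le_mul_one_add_norm_rpow_neg (ψ : 𝓢(E, F)) (k : ℕ) :
    ∃ C : ℝ, 0 ≤ C ∧ ∀ x, ‖ψ x‖ ≤ C * (1 + ‖x‖) ^ (-(k : ℝ)) := by
  refine ⟨2 ^ k * ((Finset.Iic (k, 0)).sup fun m => SchwartzMap.seminorm ℝ m.1 m.2) ψ,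
    by positivity, fun x => ?_⟩
  have h := SchwartzMap.one_add_le_sup_seminorm_apply (𝕜 := ℝ) (m := (k, 0)) (k := k) (n := 0)
    le_rfl le_rfl ψ x
  rw [norm_iteratedFDeriv_zero] at h
  have hpos : (0 : ℝ) < (1 + ‖x‖) ^ k := by positivity
  rw [Real.rpow_neg (by positivity), Real.rpow_natCast, ← div_eq_mul_inv, le_div_iff₀ hpos]
  linarith

theorem exists_integrableOn_bound_radial (ψ : 𝓢(E, F)) (k : ℕ) {c : ℝ} (hc : 0 < c) :
    ∃ b : ℝ → ℝ, IntegrableOn b (Set.Ioi 0) ∧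
      ∀ r : ℝ, 0 < r → ∀ x : E, c ≤ ‖x‖ → ‖r ^ k • ψ (r • x)‖ ≤ b r := by
  -- Of the k + 2 powers of decay, k absorb r ^ k and 2 leave a function integrable in r.
  obtain ⟨C, hC, hψ⟩ := ψ.exists_norm_le_mul_one_add_norm_rpow_neg (k + 2)
  refine ⟨fun r => C * c⁻¹ ^ k * (1 + ‖c * r‖) ^ (-2 : ℝ), ?_, fun r hr x hx => ?_⟩
  · have h : Integrable (fun r : ℝ => (1 + ‖r‖) ^ (-2 : ℝ)) :=
      integrable_one_add_norm (by simp)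
    exact ((h.comp_mul_left' hc.ne').const_mul _).integrableOn
  · have h1 : c * r ≤ ‖r • x‖ := by
      rw [norm_smul, Real.norm_of_nonneg hr.le, mul_comm]
      gcongr
    have hcr : 0 < c * r := by positivity
    beta_reduce
    rw [norm_smul, norm_pow, Real.norm_of_nonneg hr.le, Real.norm_of_nonneg hcr.le]
    calc r ^ k * ‖ψ (r • x)‖
        ≤ r ^ k * (C * (1 + ‖r • x‖) ^ (-((k + 2 : ℕ) : ℝ))) := by gcongr; exact hψ _
      _ ≤ r ^ k * (C * (1 + c * r) ^ (-((k + 2 : ℕ) : ℝ))) := by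
        gcongr r ^ k * (C * ?_)
        exact Real.rpow_le_rpow_of_nonpos (by positivity) (by linarith)
          (by simp only [Left.neg_nonpos_iff]; positivity)
      _ = C * c⁻¹ ^ k * ((c * r) ^ k * (1 + c * r) ^ (-(k : ℝ))) * (1 + c * r) ^ (-2 : ℝ) := by
        rw [show (-((k + 2 : ℕ) : ℝ)) = -(k : ℝ) + (-2) by push_cast; ring,
          Real.rpow_add (by positivity), mul_pow, inv_pow]
        field_simp
      _ ≤ C * c⁻¹ ^ k * 1 * (1 + c * r) ^ (-2 : ℝ) := by
        gcongr
        rw [Real.rpow_neg (by positivity), Real.rpow_natCast, ← div_eq_mul_inv]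
        exact div_le_one_of_le₀ (by gcongr; linarith) (by positivity)
      _ = _ := by ring

/-- The weighted integral `∫₀^∞ r ^ k ψ(r x) dr` of a Schwartz function along a ray. -/
noncomputable def radialIntegral (k : ℕ) (ψ : 𝓢(E, F)) (x : E) : F :=
  ∫ r in Set.Ioi (0 : ℝ), r ^ k • ψ (r • x)

theorem integrableOn_radial (ψ : 𝓢(E, F)) (k : ℕ) {x : E} (hx : x ≠ 0) :
    IntegrableOn (fun r : ℝ => r ^ k • ψ (r • x)) (Set.Ioi 0) := by
  obtain ⟨b, hb, hle⟩ := ψ.exists_integrableOn_bound_radial k (norm_pos_iff.mpr hx)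
  have hcont : Continuous fun r : ℝ => r ^ k • ψ (r • x) := by
    have := ψ.continuous
    fun_prop
  refine hb.mono' hcont.aestronglyMeasurable ?_
  filter_upwards [ae_restrict_mem measurableSet_Ioi] with r hr
  exact hle r hr x le_rfl

/-- The chain rule on ψ(r x) produces one more factor r, so radial integrals are closed under
differentiation. Dominating the derivative requires staying away from the origin, hence the ball of
radius ‖x‖/2. -/
theorem hasFDerivAt_radialIntegral [CompleteSpace F] (k : ℕ) (ψ : 𝓢(E, F)) {x : E} (hx : x ≠ 0) :
    HasFDerivAt (radialIntegral k ψ) (radialIntegral (k + 1) (fderivCLM ℝ E F ψ) x) x := by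
  have hpos : 0 < ‖x‖ / 2 := by have := norm_pos_iff.mpr hx; positivity
  obtain ⟨b, hb, hle⟩ :=
    (fderivCLM ℝ E F ψ).exists_integrableOn_bound_radial (k + 1) hpos
  have hψ := ψ.continuous
  have hψ' := (fderivCLM ℝ E F ψ).continuous
  unfold radialIntegral
  refine hasFDerivAt_integral_of_dominated_of_fderiv_le (bound := b)
    (F' := fun y r => r ^ (k + 1) • fderivCLM ℝ E F ψ (r • y))
    (s := ball x (‖x‖ / 2)) (ball_mem_nhds _ hpos) (.of_forall fun y => ?_)
    (ψ.integrableOn_radial k hx) ?_ ?_ hb ?_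
  · exact Continuous.aestronglyMeasurable (by fun_prop)
  · exact Continuous.aestronglyMeasurable (by fun_prop)
  · filter_upwards [ae_restrict_mem measurableSet_Ioi] with r hr y hy
    refine hle r hr y ?_
    have h1 : ‖x‖ ≤ ‖y‖ + ‖x - y‖ := by
      simpa using norm_add_le y (x - y)
    rw [mem_ball', dist_eq_norm] at hy
    linarith
  · refine .of_forall fun r y _ => ?_
    have h1 : HasFDerivAt (fun z : E => r • z) (r • ContinuousLinearMap.id ℝ E) y :=
      (hasFDerivAt_id y).const_smul r
    have h2 : HasFDerivAt ψ (fderiv ℝ ψ (r • y)) (r • y) := ψ.differentiableAt.hasFDerivAt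
    convert! (h2.comp y h1).const_smul (r ^ k) using 1
    ext v
    simp [pow_succ, mul_smul]

-- Induction on the order, with F, k and ψ all varying, since the derivative is the radial integral
-- of a Schwartz map into E →L[ℝ] F. The common universe keeps that space within reach of the
-- induction.
universe u in
theorem contDiffOn_radialIntegral {E F : Type u} [NormedAddCommGroup E] [NormedSpace ℝ E]
    [NormedAddCommGroup F] [NormedSpace ℝ F] [CompleteSpace F] (k : ℕ) (ψ : 𝓢(E, F)) :
    ContDiffOn ℝ ∞ (radialIntegral k ψ) {0}ᶜ := by
  suffices h : ∀ n : ℕ, ∀ (F : Type u) [NormedAddCommGroup F] [NormedSpace ℝ F] [CompleteSpace F]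
      (k : ℕ) (ψ : 𝓢(E, F)), ContDiffOn ℝ n (radialIntegral k ψ) {0}ᶜ from
    contDiffOn_infty.mpr fun n => h n F k ψ
  intro n
  induction n with
  | zero =>
    intro F _ _ _ k ψ
    rw [Nat.cast_zero, contDiffOn_zero]
    exact fun x hx => (hasFDerivAt_radialIntegral k ψ hx).continuousAt.continuousWithinAt
  | succ n ih =>
    intro F _ _ _ k ψ
    rw [Nat.cast_succ, contDiffOn_succ_iff_fderiv_of_isOpen isOpen_compl_singleton]
    refine ⟨fun x hx => (hasFDerivAt_radialIntegral k ψ hx).differentiableAt.differentiableWithinAt,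
      by simp, (ih _ (k + 1) (fderivCLM ℝ E F ψ)).congr fun x hx => ?_⟩
    exact (hasFDerivAt_radialIntegral k ψ hx).fderiv

end SchwartzMap

/-! ### The Fourier slice theorem. -/

section Slice

variable {V : Type*} [NormedAddCommGroup V] [InnerProductSpace ℝ V] [FiniteDimensional ℝ V]
  [MeasurableSpace V] [BorelSpace V]

/-- The splitting of an inner product space into a line and the orthogonal hyperplane
preserves volume. -/
theorem measurePreserving_smul_add_orthogonal {θ : V} (hθ : ‖θ‖ = 1) :
    MeasurePreserving (fun z : ℝ × (Submodule.span ℝ {θ})ᗮ => z.1 • θ + (z.2 : V)) := by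
  set K := Submodule.span ℝ {θ}
  have h1 : MeasurePreserving (LinearIsometryEquiv.toSpanUnitSingleton (𝕜 := ℝ) θ hθ) :=
    LinearIsometryEquiv.measurePreserving _
  have h2 := h1.prod (MeasurePreserving.id (volume : Measure Kᗮ))
  have h3 := (K.orthogonalDecomposition.symm.measurePreserving.comp
    (WithLp.volume_preserving_toLp K Kᗮ)).comp h2
  convert! h3 using 1

theorem measurableEmbedding_smul_add_orthogonal {θ : V} (hθ : ‖θ‖ = 1) :
    MeasurableEmbedding (fun z : ℝ × (Submodule.span ℝ {θ})ᗮ => z.1 • θ + (z.2 : V)) := by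
  refine (Continuous.measurableEmbedding (by fun_prop) fun z w h => ?_)
  have hθθ : inner ℝ θ θ = (1 : ℝ) := by rw [real_inner_self_eq_norm_sq, hθ]; norm_num
  have hort : ∀ y : (Submodule.span ℝ {θ})ᗮ, inner ℝ θ (y : V) = 0 := fun y =>
    Submodule.mem_orthogonal_singleton_iff_inner_right.mp y.2
  have h1 : z.1 = w.1 := by
    simpa [inner_add_right, inner_smul_right, hort, hθθ, hθ] using congrArg (inner ℝ θ) h
  refine Prod.ext h1 (Subtype.ext ?_)
  simpa [h1] using h

namespace SchwartzMap

/-- The hyperplane integrals of a Schwartz function depend continuously on the distance of the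
hyperplane from the origin. -/
theorem continuous_integral_smul_add_orthogonal (ψ : 𝓢(V, ℂ)) (θ : V) :
    Continuous fun s : ℝ => ∫ y : (Submodule.span ℝ {θ})ᗮ, ψ (s • θ + y) := by
  set K := Submodule.span ℝ {θ}
  obtain ⟨C, hC, hψ⟩ := ψ.exists_norm_le_mul_one_add_norm_rpow_neg (Module.finrank ℝ Kᗮ + 1)
  have hψc := ψ.continuous
  refine continuous_of_dominated
    (bound := fun y : Kᗮ => C * (1 + ‖y‖) ^ (-((Module.finrank ℝ Kᗮ + 1 : ℕ) : ℝ)))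
    (fun s => Continuous.aestronglyMeasurable (by fun_prop)) (fun s => .of_forall fun y => ?_)
    ((integrable_one_add_norm (by simp)).const_mul C)
    (.of_forall fun y => by fun_prop)
  refine (hψ _).trans (mul_le_mul_of_nonneg_left ?_ hC)
  have hort : inner ℝ (s • θ) (y : V) = 0 := by
    rw [inner_smul_left, Submodule.mem_orthogonal_singleton_iff_inner_right.mp y.2, mul_zero]
  have hle : ‖y‖ ≤ ‖s • θ + (y : V)‖ := by
    have h := norm_add_sq_eq_norm_sq_add_norm_sq_real hort
    have hy : ‖y‖ = ‖(y : V)‖ := rfl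
    rw [hy]
    nlinarith [norm_nonneg (s • θ + (y : V)), norm_nonneg (y : V), mul_self_nonneg ‖s • θ‖]
  exact Real.rpow_le_rpow_of_nonpos (by positivity) (by linarith)
    (by simp only [Left.neg_nonpos_iff]; positivity)

/-- **Fourier slice theorem**: the integral of the Fourier transform over a hyperplane is the
integral of the function over the orthogonal line. -/
theorem integral_orthogonal_fourier (φ : 𝓢(V, ℂ)) {θ : V} (hθ : ‖θ‖ = 1) :
    ∫ y : (Submodule.span ℝ {θ})ᗮ, (𝓕 φ) (y : V) = ∫ t : ℝ, φ (t • θ) := by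
  set K := Submodule.span ℝ {θ}
  set A : ℝ → ℂ := fun s => ∫ y : Kᗮ, (𝓕 φ) (s • θ + y) with hA
  have hmp := measurePreserving_smul_add_orthogonal hθ
  have hemb := measurableEmbedding_smul_add_orthogonal hθ
  have hint : Integrable (fun z : ℝ × Kᗮ => (𝓕 φ) (z.1 • θ + z.2)) :=
    (hmp.integrable_comp_emb hemb).mpr (𝓕 φ).integrable
  have hAc : Continuous A := (𝓕 φ).continuous_integral_smul_add_orthogonal θ
  have hAi : Integrable A := hint.integral_prod_left
  -- Fubini along ℝθ ⊕ θ^⊥: on the line ℝθ the exponential sees only the first coordinate, so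
  -- inverting φ̂ there amounts to inverting its hyperplane integrals A in one variable.
  have hinv : 𝓕⁻ A = fun t : ℝ => φ (t • θ) := by
    ext t
    have hφ : φ (t • θ) = 𝓕⁻ ((𝓕 φ : 𝓢(V, ℂ)) : V → ℂ) (t • θ) := by
      rw [← fourierInv_coe, FourierTransform.fourierInv_fourier_eq]
    rw [hφ, Real.fourierInv_eq', Real.fourierInv_eq', ← hmp.integral_comp hemb]
    have hint' : Integrable (fun z : ℝ × Kᗮ =>
        Complex.exp ((2 * Real.pi * inner ℝ z.1 t : ℝ) * Complex.I) •
          (𝓕 φ) (z.1 • θ + z.2)) := by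
      have hc : Continuous fun z : ℝ × Kᗮ =>
          Complex.exp ((2 * Real.pi * inner ℝ z.1 t : ℝ) * Complex.I) := by fun_prop
      refine hint.bdd_smul 1 hc.aestronglyMeasurable (.of_forall fun z => ?_)
      rw [Complex.norm_exp_ofReal_mul_I]
    calc _ = ∫ s : ℝ, ∫ y : Kᗮ, Complex.exp ((2 * Real.pi * inner ℝ s t : ℝ) * Complex.I) •
          (𝓕 φ) (s • θ + y) := by
          simp only [hA, integral_smul]
      _ = ∫ z : ℝ × Kᗮ, Complex.exp ((2 * Real.pi * inner ℝ z.1 t : ℝ) * Complex.I) •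
          (𝓕 φ) (z.1 • θ + z.2) := (integral_prod _ hint').symm
      _ = _ := by
          refine integral_congr_ae (.of_forall fun z => ?_)
          have h0 : inner ℝ (z.2 : V) θ = 0 :=
            Submodule.mem_orthogonal_singleton_iff_inner_left.mp z.2.2
          have h1 : inner ℝ (z.1 • θ + (z.2 : V)) (t • θ) = inner ℝ z.1 t := by
            rw [inner_add_left, inner_smul_right, inner_smul_right, inner_smul_left, h0,
              real_inner_self_eq_norm_sq, hθ]
            simp
          simp only [h1]
  have hai : Integrable (fun t : ℝ => φ (t • θ)) := by
    have hanti : AntilipschitzWith 1 (ContinuousLinearMap.toSpanSingleton ℝ θ) :=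
      AddMonoidHomClass.antilipschitz_of_bound _ fun t => by simp [norm_smul, hθ]
    exact (compCLMOfAntilipschitz ℝ
      (ContinuousLinearMap.toSpanSingleton ℝ θ).hasTemperateGrowth hanti φ).integrable
  have hFA : Integrable (𝓕 A) := by
    have h : 𝓕 A = fun t : ℝ => φ ((-t) • θ) := by
      ext t
      rw [← congrFun hinv (-t), Real.fourierInv_eq_fourier_neg, neg_neg]
    rw [h]
    exact hai.comp_neg
  -- One-dimensional inversion at 0, where the Fourier integral of t ↦ φ(tθ) is its plain integral.
  have hkey : A 0 = 𝓕 (𝓕⁻ A) 0 := (hAi.fourier_fourierInv_eq hFA hAc.continuousAt).symm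
  have hA0 : A 0 = ∫ y : Kᗮ, (𝓕 φ) (y : V) := by simp [hA]
  rw [← hA0, hkey, hinv, Real.fourier_eq']
  simp

end SchwartzMap

end Slice

/-- The graph of t^p lies above its tangent at a: Bernoulli's inequality at b/a - 1, rescaled by
a^p. -/
theorem Real.rpow_add_mul_sub_le_rpow {a b p : ℝ} (ha : 0 < a) (hb : 0 < b) (hp : 1 ≤ p) :
    a ^ p + p * (a ^ (p - 1) * (b - a)) ≤ b ^ p := by
  have h := one_add_mul_self_le_rpow_one_add (s := b / a - 1) (by have := div_pos hb ha; linarith) hp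
  rw [add_sub_cancel, Real.div_rpow hb.le ha.le, le_div_iff₀ (by positivity)] at h
  refine le_of_eq_of_le ?_ h
  rw [Real.rpow_sub_one ha.ne']
  field_simp

theorem Real.rpow_le_rpow_add_mul_sub {a b p : ℝ} (ha : 0 < a) (hb : 0 < b) (hp : 0 ≤ p)
    (hp1 : p ≤ 1) : b ^ p ≤ a ^ p + p * (a ^ (p - 1) * (b - a)) := by
  have h := rpow_one_add_le_one_add_mul_self (s := b / a - 1)
    (by have := div_pos hb ha; linarith) hp hp1
  rw [add_sub_cancel, Real.div_rpow hb.le ha.le, div_le_iff₀ (by positivity)] at h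
  refine h.trans_eq ?_
  rw [Real.rpow_sub_one ha.ne']
  field_simp

theorem SchwartzMap.fourier_neg_eq_conj_of_nonneg {V : Type*} [NormedAddCommGroup V]
    [InnerProductSpace ℝ V] [FiniteDimensional ℝ V] [MeasurableSpace V] [BorelSpace V]
    {φ : 𝓢(V, ℂ)} (hφ : ∀ x, 0 ≤ φ x) (x : V) :
    (𝓕 φ) (-x) = (starRingEnd ℂ) ((𝓕 φ) x) := by
  have h : ∀ y, (starRingEnd ℂ) (φ y) = φ y := fun y =>
    Complex.conj_eq_iff_im.mpr (Complex.nonneg_iff.mp (hφ y)).2.symm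
  rw [fourier_coe, Real.fourier_eq', Real.fourier_eq', ← integral_conj]
  refine integral_congr_ae (.of_forall fun y => ?_)
  simp [h, ← Complex.exp_conj, Complex.conj_ofNat]

/-! ### Homogeneous extensions and test functions on the sphere. -/

section Sphere

variable {d : ℕ}

theorem SphereSmooth.continuous {f : Sph d → ℝ} (hf : SphereSmooth f) : Continuous f :=
  ContMDiff.continuous hf

theorem SphereSmooth.add_const_mul {f u : Sph d → ℝ} (hf : SphereSmooth f) (hu : SphereSmooth u)
    (c : ℝ) : SphereSmooth fun θ => f θ + c * u θ :=
  ContMDiff.add hf (contMDiff_const.mul hu)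

theorem sphereSmooth_of_contDiffOn {f : Euc d → ℝ} (hf : ContDiffOn ℝ ∞ f {0}ᶜ) :
    SphereSmooth fun θ : Sph d => f θ := by
  have hfact : Fact (Module.finrank ℝ (Euc d) = d + 1) := ⟨by simp⟩
  have hcoe : ContMDiff (𝓡 d) 𝓘(ℝ, Euc d) ∞ ((↑) : Sph d → Euc d) := contMDiff_coe_sphere
  exact hf.contMDiffOn.comp_contMDiff hcoe fun θ => ne_zero_of_mem_unit_sphere θ

instance : IsFiniteMeasure (surfaceMeasure d) := by
  unfold surfaceMeasure; infer_instance

theorem integrable_surfaceMeasure {f : Sph d → ℝ} (hf : Continuous f) :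
    Integrable f (surfaceMeasure d) :=
  hf.integrable_of_hasCompactSupport (HasCompactSupport.of_compactSpace f)

theorem continuous_sectionPoint (θ : Sph d) : Continuous (sectionPoint θ) :=
  Continuous.subtype_mk (by fun_prop) _

theorem sphericalRadon_add_const_mul {f u : Sph d → ℝ} (hf : Continuous f) (hu : Continuous u)
    (c : ℝ) (θ : Sph d) :
    sphericalRadon (fun ξ => f ξ + c * u ξ) θ = sphericalRadon f θ + c * sphericalRadon u θ := by
  have hint : ∀ v : Sph d → ℝ, Continuous v → Integrable (fun ξ => v (sectionPoint θ ξ))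
      (volume : Measure ((Submodule.span ℝ {(θ : Euc d)})ᗮ)).toSphere := fun v hv =>
    (hv.comp (continuous_sectionPoint θ)).integrable_of_hasCompactSupport
      (HasCompactSupport.of_compactSpace _)
  unfold sphericalRadon
  rw [integral_add (hint f hf) ((hint u hu).const_mul c), integral_const_mul]

theorem homExt_smul (h : Sph d → ℝ) (ξ : Sph d) {r : ℝ} (hr : 0 < r) :
    homExt h (r • (ξ : Euc d)) = r⁻¹ * h ξ := by
  have hξ : ‖(ξ : Euc d)‖ = 1 := norm_eq_of_mem_sphere ξ
  have hne : r • (ξ : Euc d) ≠ 0 := smul_ne_zero hr.ne' (ne_zero_of_mem_unit_sphere ξ)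
  have hn : ‖r • (ξ : Euc d)‖ = r := by rw [norm_smul, hξ, Real.norm_of_nonneg hr.le, mul_one]
  have hp : radialProj _ hne = ξ := by
    apply Subtype.ext
    simp only [radialProj, hn, smul_smul, inv_mul_cancel₀ hr.ne', one_smul]
  rw [homExt, dif_pos hne, hp, hn]

theorem homExt_neg {h : Sph d → ℝ} (hh : Function.Even h) (x : Euc d) :
    homExt h (-x) = homExt h x := by
  by_cases hx : x = 0
  · simp [hx]
  · have hp : radialProj (-x) (neg_ne_zero.mpr hx) = -radialProj x hx :=
      Subtype.ext (by simp [radialProj])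
    rw [homExt, homExt, dif_pos (neg_ne_zero.mpr hx), dif_pos hx, hp, hh, norm_neg]

theorem continuousOn_homExt {h : Sph d → ℝ} (hh : Continuous h) :
    ContinuousOn (homExt h) {0}ᶜ := by
  rw [continuousOn_iff_continuous_domRestrict]
  have heq : Set.domRestrict {0}ᶜ (homExt h) =
      fun x : ({0}ᶜ : Set (Euc d)) => ‖(x : Euc d)‖⁻¹ * h (radialProj x x.2) := by
    ext x
    exact dif_pos x.2
  have hne : ∀ x : ({0}ᶜ : Set (Euc d)), ‖(x : Euc d)‖ ≠ 0 := fun x => norm_ne_zero_iff.mpr x.2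
  have hinv : Continuous fun x : ({0}ᶜ : Set (Euc d)) => ‖(x : Euc d)‖⁻¹ :=
    Continuous.inv₀ (by fun_prop) hne
  rw [heq]
  exact hinv.mul (hh.comp (Continuous.subtype_mk (hinv.smul continuous_subtype_val) _))

theorem integrable_homExt_mul (hd : 1 ≤ d) {h : Sph d → ℝ} (hh : Continuous h)
    (ψ : 𝓢(Euc d, ℂ)) : Integrable fun x => (homExt h x : ℂ) * ψ x := by
  obtain ⟨M, hM⟩ := isCompact_univ.exists_bound_of_continuousOn hh.continuousOn
  -- With polar weight r^d and the factor r⁻¹, decay of order d + 1 leaves (1 + r)^(-2). The bound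
  -- at the origin uses d ≥ 1.
  obtain ⟨C, hC, hψ⟩ := ψ.exists_norm_le_mul_one_add_norm_rpow_neg (d + 1)
  have hM0 : 0 ≤ max M 0 := le_max_right _ _
  have hb : Integrable fun x : Euc d =>
      max M 0 * C * (‖x‖⁻¹ * (1 + ‖x‖) ^ (-((d + 1 : ℕ) : ℝ))) := by
    refine Integrable.const_mul ?_ _
    rw [integrable_fun_norm_addHaar volume
      (f := fun r : ℝ => r⁻¹ * (1 + r) ^ (-((d + 1 : ℕ) : ℝ)))]
    have h2 : IntegrableOn (fun r : ℝ => (1 + ‖r‖) ^ (-2 : ℝ)) (Set.Ioi 0) :=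
      (integrable_one_add_norm (by simp)).integrableOn
    refine h2.mono' ?_ ?_
    · refine ContinuousOn.aestronglyMeasurable ?_ measurableSet_Ioi
      intro r hr
      have hr0 : r ≠ 0 := ne_of_gt hr
      have hr1 : 1 + r ≠ 0 := by have : 0 < r := hr; positivity
      refine ContinuousAt.continuousWithinAt ?_
      exact (continuousAt_id.pow _).smul ((continuousAt_id.inv₀ hr0).mul
        ((continuousAt_const.add continuousAt_id).rpow_const (.inl hr1)))
    · filter_upwards [ae_restrict_mem measurableSet_Ioi] with r hr
      have hr : 0 < r := hr
      obtain ⟨e, rfl⟩ : ∃ e, d = e + 1 := ⟨d - 1, by omega⟩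
      have hfin : Module.finrank ℝ (Euc (e + 1)) - 1 = e + 1 := by simp
      rw [hfin, smul_eq_mul, Real.norm_of_nonneg (by positivity), Real.norm_of_nonneg hr.le]
      calc r ^ (e + 1) * (r⁻¹ * (1 + r) ^ (-((e + 1 + 1 : ℕ) : ℝ)))
          = (r ^ e * (1 + r) ^ (-(e : ℝ))) * (1 + r) ^ (-2 : ℝ) := by
            rw [show (-((e + 1 + 1 : ℕ) : ℝ)) = -(e : ℝ) + (-2) by push_cast; ring,
              Real.rpow_add (by positivity), pow_succ]
            field_simp
        _ ≤ 1 * (1 + r) ^ (-2 : ℝ) := by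
            gcongr
            rw [Real.rpow_neg (by positivity), Real.rpow_natCast, ← div_eq_mul_inv]
            exact div_le_one_of_le₀ (by gcongr; linarith) (by positivity)
        _ = _ := one_mul _
  refine hb.mono' ?_ (.of_forall fun x => ?_)
  · rw [← restrict_compl_singleton (μ := volume) (0 : Euc d)]
    refine ContinuousOn.aestronglyMeasurable ?_ (measurableSet_singleton _).compl
    exact (Complex.continuous_ofReal.comp_continuousOn (continuousOn_homExt hh)).mul
      ψ.continuous.continuousOn
  · have hF : ‖homExt h x‖ ≤ max M 0 * ‖x‖⁻¹ := by
      unfold homExt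
      split_ifs with hx
      · rw [norm_mul, norm_inv, norm_norm, mul_comm]
        gcongr
        exact (hM _ (Set.mem_univ _)).trans (le_max_left _ _)
      · simp only [norm_zero]; positivity
    rw [norm_mul, Complex.norm_real]
    calc _ ≤ (max M 0 * ‖x‖⁻¹) * (C * (1 + ‖x‖) ^ (-((d + 1 : ℕ) : ℝ))) := by
          gcongr; exact hψ x
      _ = _ := by ring

theorem continuous_radialIntegral_sphere (k : ℕ) (ψ : 𝓢(Euc d, ℂ)) :
    Continuous fun ξ : Sph d => ψ.radialIntegral k ξ :=
  (ψ.contDiffOn_radialIntegral k).continuousOn.comp_continuous continuous_subtype_val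
    fun ξ => ne_zero_of_mem_unit_sphere ξ

/-- Testing `homExt h` against a Schwartz function is testing `h` on the sphere against a radial
integral. -/
theorem integral_homExt_mul (hd : 1 ≤ d) {h : Sph d → ℝ} (hh : Continuous h) (ψ : 𝓢(Euc d, ℂ)) :
    ∫ x, (homExt h x : ℂ) * ψ x = ∫ ξ, (h ξ : ℂ) * ψ.radialIntegral (d - 1) ξ ∂surfaceMeasure d := by
  rw [integral_eq_integral_toSphere_integral_Ioi volume (integrable_homExt_mul hd hh ψ)]
  refine integral_congr_ae (.of_forall fun ξ => ?_)
  obtain ⟨e, rfl⟩ : ∃ e, d = e + 1 := ⟨d - 1, by omega⟩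
  have hfin : Module.finrank ℝ (Euc (e + 1)) - 1 = e + 1 := by simp
  simp only [hfin, SchwartzMap.radialIntegral, Nat.add_sub_cancel]
  rw [← integral_const_mul]
  refine setIntegral_congr_fun measurableSet_Ioi fun r hr => ?_
  have hr0 : (r : ℂ) ≠ 0 := Complex.ofReal_ne_zero.mpr (ne_of_gt hr)
  simp only [homExt_smul h ξ hr, Complex.real_smul]
  push_cast
  field_simp
  ring

/-- The spherical Radon transform of a radial integral of `φ̂` is a line integral of `φ`. -/
theorem integral_sectionPoint_radialIntegral_fourier (hd : 1 ≤ d) (φ : 𝓢(Euc d, ℂ)) (θ : Sph d) :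
    ∫ ξ, (𝓕 φ).radialIntegral (d - 1) (sectionPoint θ ξ)
      ∂((volume : Measure ((Submodule.span ℝ {(θ : Euc d)})ᗮ)).toSphere) =
      ∫ t : ℝ, φ (t • (θ : Euc d)) := by
  have hθ : ‖(θ : Euc d)‖ = 1 := norm_eq_of_mem_sphere θ
  rw [← φ.integral_orthogonal_fourier hθ]
  set K := Submodule.span ℝ {(θ : Euc d)}
  have hfact : Fact (Module.finrank ℝ (Euc d) = d + 1) := ⟨by simp⟩
  have hfin : Module.finrank ℝ Kᗮ = d :=
    Submodule.finrank_orthogonal_span_singleton (ne_zero_of_mem_unit_sphere θ)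
  have hnt : Nontrivial Kᗮ := Module.nontrivial_of_finrank_pos (R := ℝ) (by omega)
  have hint : Integrable (fun y : Kᗮ => (𝓕 φ) (y : Euc d)) := by
    have hanti : AntilipschitzWith 1 Kᗮ.subtypeL :=
      AddMonoidHomClass.antilipschitz_of_bound _ fun y => by simp
    exact (SchwartzMap.compCLMOfAntilipschitz ℝ Kᗮ.subtypeL.hasTemperateGrowth hanti
      (𝓕 φ)).integrable
  -- Since θ^⊥ has dimension d, its polar weight is exactly the r^(d-1) of the radial integral.
  rw [integral_eq_integral_toSphere_integral_Ioi volume hint, hfin]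
  rfl

/-- If `homExt h` is not positive definite, then some smooth even function with nonnegative
spherical Radon transform has negative integral against `h`. -/
theorem exists_sphericalRadon_nonneg_integral_mul_neg (hd : 1 ≤ d) {h : Sph d → ℝ}
    (hh : Continuous h) (heven : Function.Even h)
    (hnot : ¬ IsPositiveDefiniteDistribution (homExt h)) :
    ∃ u : Sph d → ℝ, SphereSmooth u ∧ Function.Even u ∧ (∀ θ, 0 ≤ sphericalRadon u θ) ∧
      ∫ θ, h θ * u θ ∂surfaceMeasure d < 0 := by
  unfold IsPositiveDefiniteDistribution at hnot
  push Not at hnot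
  obtain ⟨φ, hφ, hneg⟩ := hnot
  set U : Euc d → ℂ := (𝓕 φ).radialIntegral (d - 1) with hU
  have hUc : Continuous fun ξ : Sph d => U ξ := continuous_radialIntegral_sphere _ _
  refine ⟨fun θ => (U θ).re, sphereSmooth_of_contDiffOn
    (Complex.reCLM.contDiff.comp_contDiffOn ((𝓕 φ).contDiffOn_radialIntegral (d - 1))),
    fun θ => ?_, fun θ => ?_, ?_⟩
  · have hconj : U (-(θ : Euc d)) = (starRingEnd ℂ) (U θ) := by
      simp only [hU, SchwartzMap.radialIntegral]
      rw [← integral_conj]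
      simp [SchwartzMap.fourier_neg_eq_conj_of_nonneg hφ]
    change (U (-(θ : Euc d))).re = _
    rw [hconj, Complex.conj_re]
  · have hint : Integrable (fun ξ => U (sectionPoint θ ξ))
        (volume : Measure ((Submodule.span ℝ {(θ : Euc d)})ᗮ)).toSphere :=
      (hUc.comp (continuous_sectionPoint θ)).integrable_of_hasCompactSupport
        (HasCompactSupport.of_compactSpace _)
    have h1 : sphericalRadon (fun θ => (U θ).re) θ = (∫ t : ℝ, φ (t • (θ : Euc d))).re := by
      rw [← integral_sectionPoint_radialIntegral_fourier hd φ θ]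
      exact integral_re hint
    rw [h1]
    exact (Complex.nonneg_iff.mp (integral_nonneg fun t => hφ _)).1
  -- In the order on ℂ, 0 ≤ z could also fail through a nonzero imaginary part. Evenness of h rules
  -- this out, so the failure means that the real part is negative.
  · set z : ℂ := ∫ x, (homExt h x : ℂ) * (𝓕 φ) x with hz
    have hzim : z.im = 0 := by
      rw [← Complex.conj_eq_iff_im, hz, ← integral_conj]
      conv_rhs => rw [← integral_neg_eq_self]
      refine integral_congr_ae (.of_forall fun x => ?_)
      simp [homExt_neg heven, SchwartzMap.fourier_neg_eq_conj_of_nonneg hφ]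
    have hre : z.re < 0 := by
      by_contra! hcon
      exact hneg (Complex.nonneg_iff.mpr ⟨hcon, hzim.symm⟩)
    have hint : Integrable (fun ξ : Sph d => (h ξ : ℂ) * U ξ) (surfaceMeasure d) :=
      ((Complex.continuous_ofReal.comp hh).mul hUc).integrable_of_hasCompactSupport
        (HasCompactSupport.of_compactSpace _)
    rw [hz, integral_homExt_mul hd hh] at hre
    refine lt_of_eq_of_lt ?_ hre
    refine Eq.trans ?_ (integral_re hint)
    simp

/-! ### Comparison of norms and the perturbation argument. -/

theorem sphereLpNorm_lt_of_integral_rpow_lt {p : ℝ} (hp : 0 < p) {f g : Sph d → ℝ}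
    (hf : Continuous f) (hg : Continuous g) (hf0 : ∀ θ, 0 < f θ) (hg0 : ∀ θ, 0 < g θ)
    (hlt : ∫ θ, f θ ^ p ∂surfaceMeasure d < ∫ θ, g θ ^ p ∂surfaceMeasure d) :
    sphereLpNorm p f < sphereLpNorm p g := by
  have key : ∀ v : Sph d → ℝ, Continuous v → (∀ θ, 0 < v θ) →
      sphereLpNorm p v = ENNReal.ofReal ((∫ θ, v θ ^ p ∂surfaceMeasure d) ^ p⁻¹) := by
    intro v hv hv0
    have hmem : MemLp v (ENNReal.ofReal p) (surfaceMeasure d) :=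
      hv.memLp_of_hasCompactSupport (HasCompactSupport.of_compactSpace v)
    rw [sphereLpNorm, hmem.eLpNorm_eq_integral_rpow_norm (by simpa using hp) ENNReal.ofReal_ne_top,
      ENNReal.toReal_ofReal hp.le]
    simp only [Real.norm_of_nonneg (hv0 _).le]
  have h0 : 0 ≤ ∫ θ, f θ ^ p ∂surfaceMeasure d :=
    integral_nonneg fun θ => Real.rpow_nonneg (hf0 θ).le p
  rw [key f hf hf0, key g hg hg0, ENNReal.ofReal_lt_ofReal_iff_of_nonneg (by positivity)]
  exact Real.rpow_lt_rpow h0 hlt (by positivity)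

theorem exists_pos_forall_abs_mul_lt {f u : Sph d → ℝ} (hf : Continuous f) (hu : Continuous u)
    (hf0 : ∀ θ, 0 < f θ) : ∃ ε : ℝ, 0 < ε ∧ ∀ θ, |ε * u θ| < f θ := by
  have hq : Continuous fun θ => |u θ| / f θ := hu.abs.div₀ hf fun θ => (hf0 θ).ne'
  obtain ⟨M, hM⟩ := isCompact_univ.exists_bound_of_continuousOn hq.continuousOn
  have hM1 : 0 < |M| + 1 := by positivity
  -- M bounds |u|/f on the compact sphere; adding 1 makes the inequality strict.
  refine ⟨(|M| + 1)⁻¹, by positivity, fun θ => ?_⟩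
  have h1 : |u θ| / f θ < |M| + 1 := by
    linarith [le_abs_self M, (le_abs_self _).trans (hM θ (Set.mem_univ θ))]
  rw [div_lt_iff₀ (hf0 θ)] at h1
  rw [abs_mul, abs_of_pos (inv_pos.mpr hM1), inv_mul_lt_iff₀ hM1]
  exact h1

theorem continuous_rpow_of_pos {f : Sph d → ℝ} (hf : Continuous f) (hf0 : ∀ θ, 0 < f θ) (q : ℝ) :
    Continuous fun θ => f θ ^ q :=
  hf.rpow_const fun θ => .inl (hf0 θ).ne'

theorem integral_rpow_add_mul_rpow {f u : Sph d → ℝ} (hf : Continuous f) (hu : Continuous u)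
    (hf0 : ∀ θ, 0 < f θ) (p c : ℝ) :
    Integrable (fun θ => f θ ^ p + p * (f θ ^ (p - 1) * ((f θ + c * u θ) - f θ)))
      (surfaceMeasure d) ∧
    ∫ θ, (f θ ^ p + p * (f θ ^ (p - 1) * ((f θ + c * u θ) - f θ))) ∂surfaceMeasure d =
      ∫ θ, f θ ^ p ∂surfaceMeasure d +
        p * c * ∫ θ, f θ ^ (p - 1) * u θ ∂surfaceMeasure d := by
  have h1 := continuous_rpow_of_pos hf hf0 p
  have h2 : Continuous fun θ => f θ ^ (p - 1) * u θ :=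
    (continuous_rpow_of_pos hf hf0 (p - 1)).mul hu
  have heq : (fun θ => f θ ^ p + p * (f θ ^ (p - 1) * ((f θ + c * u θ) - f θ))) =
      fun θ => f θ ^ p + p * c * (f θ ^ (p - 1) * u θ) := by
    ext θ; ring
  have hi := (integrable_surfaceMeasure h2).const_mul (p * c)
  rw [heq]
  exact ⟨(integrable_surfaceMeasure h1).add hi, by
    rw [integral_add (integrable_surfaceMeasure h1) hi, integral_const_mul]⟩

end Sphere

theorem theoremt (d : ℕ) (hd : 1 ≤ d) :
    -- part (a)
    (∀ (p : ℝ) (g : Sph d → ℝ), 1 < p →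
      SphereSmooth g → (∀ θ, 0 < g θ) → Function.Even g →
      ¬ IsPositiveDefiniteDistribution (homExt fun θ => g θ ^ (p - 1)) →
      ∃ f : Sph d → ℝ, SphereSmooth f ∧ (∀ θ, 0 < f θ) ∧ Function.Even f ∧
        (∀ θ, sphericalRadon f θ ≤ sphericalRadon g θ) ∧
        sphereLpNorm p g < sphereLpNorm p f) ∧
    -- part (b)
    (∀ (p : ℝ) (f : Sph d → ℝ), 0 < p → p < 1 →
      SphereSmooth f → (∀ θ, 0 < f θ) → Function.Even f →
      ¬ IsPositiveDefiniteDistribution (homExt fun θ => f θ ^ (p - 1)) →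
      ∃ g : Sph d → ℝ, SphereSmooth g ∧ (∀ θ, 0 < g θ) ∧ Function.Even g ∧
        (∀ θ, sphericalRadon f θ ≤ sphericalRadon g θ) ∧
        sphereLpNorm p g < sphereLpNorm p f) := by
  constructor
  · intro p g hp hg hg0 hge hnot
    obtain ⟨u, hu, hue, hRu, hneg⟩ := exists_sphericalRadon_nonneg_integral_mul_neg hd
      (continuous_rpow_of_pos hg.continuous hg0 (p - 1)) (fun θ => by simp only [hge θ]) hnot
    obtain ⟨ε, hε, hlt⟩ := exists_pos_forall_abs_mul_lt hg.continuous hu.continuous hg0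
    have hf := hg.add_const_mul hu (-ε)
    have hf0 : ∀ θ, 0 < g θ + -ε * u θ := fun θ => by linarith [(abs_lt.mp (hlt θ)).2]
    refine ⟨_, hf, hf0, fun θ => by simp only [hge θ, hue θ], fun θ => ?_, ?_⟩
    · rw [sphericalRadon_add_const_mul hg.continuous hu.continuous]
      nlinarith [hRu θ]
    · refine sphereLpNorm_lt_of_integral_rpow_lt (by linarith) hg.continuous hf.continuous hg0 hf0 ?_
      obtain ⟨hi, heq⟩ := integral_rpow_add_mul_rpow hg.continuous hu.continuous hg0 p (-ε)
      -- Integrated tangent-line inequality: the first-order term -pε ∫ g^(p-1) u is positive.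
      have hle := integral_mono hi
        (integrable_surfaceMeasure (continuous_rpow_of_pos hf.continuous hf0 p))
        fun θ => Real.rpow_add_mul_sub_le_rpow (hg0 θ) (hf0 θ) hp.le
      rw [heq] at hle
      have hpos : 0 < p * -ε * ∫ θ, g θ ^ (p - 1) * u θ ∂surfaceMeasure d :=
        mul_pos_of_neg_of_neg (mul_neg_of_pos_of_neg (by linarith) (by linarith)) hneg
      linarith
  · intro p f hp hp1 hf hf0 hfe hnot
    obtain ⟨u, hu, hue, hRu, hneg⟩ := exists_sphericalRadon_nonneg_integral_mul_neg hd
      (continuous_rpow_of_pos hf.continuous hf0 (p - 1)) (fun θ => by simp only [hfe θ]) hnot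
    obtain ⟨ε, hε, hlt⟩ := exists_pos_forall_abs_mul_lt hf.continuous hu.continuous hf0
    have hg := hf.add_const_mul hu ε
    have hg0 : ∀ θ, 0 < f θ + ε * u θ := fun θ => by linarith [(abs_lt.mp (hlt θ)).1]
    refine ⟨_, hg, hg0, fun θ => by simp only [hfe θ, hue θ], fun θ => ?_, ?_⟩
    · rw [sphericalRadon_add_const_mul hf.continuous hu.continuous]
      nlinarith [hRu θ]
    · refine sphereLpNorm_lt_of_integral_rpow_lt hp hg.continuous hf.continuous hg0 hf0 ?_
      obtain ⟨hi, heq⟩ := integral_rpow_add_mul_rpow hf.continuous hu.continuous hf0 p ε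
      -- By concavity the tangent now bounds from above, and the first-order term is negative.
      have hle := integral_mono
        (integrable_surfaceMeasure (continuous_rpow_of_pos hg.continuous hg0 p)) hi
        fun θ => Real.rpow_le_rpow_add_mul_sub (hf0 θ) (hg0 θ) hp.le hp1.le
      rw [heq] at hle
      have hneg' : p * ε * ∫ θ, f θ ^ (p - 1) * u θ ∂surfaceMeasure d < 0 :=
        mul_neg_of_pos_of_neg (by positivity) hneg
      linarith
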